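/- All digraphs are finite and have no loops and no parallel arcs (two opposite arcs $(u,v)$ and $(v,u)$ are allowed); $A(H)$ denotes the arc set of $H$. For a digraph $D$ and sets $Z_1, Z_2 \subseteq A(D)$, let $\mu(D,Z_1,Z_2)$ be the minimum number of parts in a partition $\mathcal P$ of the vertex set of $D$ such that for every $X \in \mathcal P$ the subdigraph of $D$ induced by $X$ contains no directed cycle $C$ with $|A(C)\cap Z_1| \ne |A(C)\cap Z_2|$. A subdivision of a digraph $F$ is a digraph obtained from $F$ by replacing each arc $e=(u,v)$ by a directed path $P_e$ from $u$ to $v$ of length at least $1$ (length $1$ meaning that $e$ is kept), where all internal vertices of these paths are new and the paths are pairwise internally vertex-disjoint; $P_e$ is called the branching path corresponding to $e$. **Theorem.** Let $F$ be a digraph, and for every arc $e$ of $F$ let $(a_e, b_e, r_e, q_e)$ be a tuple of integers with $q_e \ge 2$ and $\gcd(a_e,q_e)=\gcd(b_e,q_e)=1$. Then there is an integer $N$ such that the following holds. Let $D$ be a digraph and $Z_1, Z_2 \subseteq A(D)$. If $\mu(D,Z_1,Z_2) \ge N$, then $D$ contains a subdigraph isomorphic to a subdivision of $F$ in which, for every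 arc $e$ of $F$, the branching path $P_e$ corresponding to $e$ satisfies $$a_e\,|A(P_e)\cap Z_1| + b_e\,|A(P_e)\cap Z_2| \equiv r_e \pmod{q_e}.$$ -/

import Mathlib

namespace Digraph

variable {V W : Type*}

/-- The arc set `A(D)`: the arc `(u, v)` has tail `u` and head `v`. -/
def arcs (D : Digraph V) : Set (V × V) := {e | D.Adj e.1 e.2}

/-- A digraph without loops. (Parallel arcs do not occur in a `Digraph`; a pair of opposite arcs
`(u, v)`, `(v, u)` may.) -/
def Loopless (D : Digraph V) : Prop := ∀ v, ¬ D.Adj v v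

/-- A subdigraph of `D`: some of the vertices and some of the arcs between them. -/
structure Subdigraph (D : Digraph V) where
  verts : Set V
  arcs : Set (V × V)
  arcs_subset : arcs ⊆ D.arcs
  fst_mem : ∀ e ∈ arcs, e.1 ∈ verts
  snd_mem : ∀ e ∈ arcs, e.2 ∈ verts

/-- The subdigraph `D[X]` induced by the vertex set `X`. -/
def induced (D : Digraph V) (X : Set V) : Subdigraph D where
  verts := X
  arcs := {e | e ∈ D.arcs ∧ e.1 ∈ X ∧ e.2 ∈ X}
  arcs_subset _ he := he.1
  fst_mem _ he := he.2.1
  snd_mem _ he := he.2.2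

/-- The arcs of the directed path that visits the vertices of the list `p` in this order:
the pairs of consecutive entries. -/
def pathArcs (p : List V) : Set (V × V) := {e | e ∈ p.zip p.tail}

/-- The arcs of the directed cycle that visits the vertices of the list `c` in this cyclic order:
the pairs of cyclically consecutive entries. -/
def cycleArcs (c : List V) : Set (V × V) := {e | e ∈ c.zip (c.rotate 1)}

/-- The internal vertices of the path with vertex sequence `p`: all but the first and the last. -/
def internalVerts (p : List V) : Set V := {x | x ∈ p.tail.dropLast}

/-- The list `p` is the vertex sequence of a directed path of `H` from `u` to `v`. -/
structure Subdigraph.IsDipath {D : Digraph V} (H : Subdigraph D) (u v : V) (p : List V) :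
    Prop where
  nodup : p.Nodup
  head_eq : p.head? = some u
  last_eq : p.getLast? = some v
  verts_mem : ∀ x ∈ p, x ∈ H.verts
  arcs_subset : pathArcs p ⊆ H.arcs

/-- The list `c` is the vertex sequence of a directed cycle of `H`
(so `c` has length at least 2 if there are no loops). -/
structure Subdigraph.IsDicycle {D : Digraph V} (H : Subdigraph D) (c : List V) : Prop where
  ne_nil : c ≠ []
  nodup : c.Nodup
  verts_mem : ∀ x ∈ c, x ∈ H.verts
  arcs_subset : cycleArcs c ⊆ H.arcs

/-- The cycle with vertex sequence `c` is `(Z₁, Z₂)`-unbalanced: `|A(C) ∩ Z₁| ≠ |A(C) ∩ Z₂|`. -/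
def Unbalanced (Z₁ Z₂ : Set (V × V)) (c : List V) : Prop :=
  (cycleArcs c ∩ Z₁).ncard ≠ (cycleArcs c ∩ Z₂).ncard

/-- The `(Z₁, Z₂)`-unbalanced dichromatic number `μ(D, Z₁, Z₂)`: the least number of parts in a
partition of the vertex set into (nonempty) parts, each of which induces a subdigraph without
`(Z₁, Z₂)`-unbalanced directed cycles. -/
noncomputable def unbalancedDichromaticNumber (D : Digraph V) (Z₁ Z₂ : Set (V × V)) : ℕ∞ :=
  sInf {k : ℕ∞ | ∃ P : Set (Set V), Setoid.IsPartition P ∧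
    (∀ X ∈ P, ¬ ∃ c : List V, (D.induced X).IsDicycle c ∧ Unbalanced Z₁ Z₂ c) ∧
    P.encard = k}

/-- The subdigraph `H` of `D` is (isomorphic to) a subdivision of `F`, with branching vertices
`branch w` and branching paths `path e`: it arises from a copy of `F` by replacing each arc
`e = (x, y)` by a directed path from `branch x` to `branch y` (possibly a single arc, in which case
`e` is kept), where the internal vertices are new and the paths are pairwise internally
vertex-disjoint, and `H` has no further vertices or arcs. -/
structure Subdigraph.IsSubdivision {D : Digraph V} (H : Subdigraph D) (F : Digraph W)
    (branch : W → V) (path : F.arcs → List V) : Prop where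
  branch_injective : Function.Injective branch
  isDipath : ∀ e : F.arcs, H.IsDipath (branch e.1.1) (branch e.1.2) (path e)
  internal_new : ∀ e : F.arcs, Disjoint (internalVerts (path e)) (Set.range branch)
  internal_disjoint : ∀ e f : F.arcs, e ≠ f →
    Disjoint (internalVerts (path e)) (internalVerts (path f))
  verts_eq : H.verts = Set.range branch ∪ ⋃ e : F.arcs, {x | x ∈ path e}
  arcs_eq : H.arcs = ⋃ e : F.arcs, pathArcs (path e)

end Digraph

namespace Digraph

open Relation

variable {V : Type*} {D : Digraph V} {Z₁ Z₂ : Set (V × V)}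

/-! ### Cycles -/

/-! For one arc `e` of `F`, weigh the arcs of `D` in `ZMod q_e`: `a_e` for membership in `Z₁` plus
`b_e` for membership in `Z₂`. The core is `exists_linking_all_weights`: a set `X` needing many
colours contains a set `J` still needing many, any two distinct vertices of which are joined by
paths of every weight with interior in `X \ J`. Repeating this inside `J` for the other arcs, and
choosing the branch vertices in the innermost set, makes the branching paths internally disjoint
(`exists_branching_paths`).

Intersecting an out-layer and an in-layer of breadth-first searches in a strong component gives such
a `J` with uncontrolled weights (`exists_linking`). To control them, suppose that all paths with
common ends have weights congruent modulo a proper subgroup `H`. Colour a search layer by the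
weights of the search paths: arcs inside a colour class have weight in `H`. As `H` contains no unit,
these arcs lie in both or neither of `Z₁`, `Z₂`, so monochromatic cycles are balanced. Hence many
colours force two weights that differ modulo `H` (`exists_linked_sub_notMem`). Taking for `H` the
stabilizer of the set of weights obtained so far, and chaining, enlarges that set until it is the
whole group (`exists_linked_weights`). -/

theorem fst_mem_of_mem_cycleArcs {c : List V} {e : V × V} (h : e ∈ cycleArcs c) : e.1 ∈ c :=
  (List.of_mem_zip (a := e.1) (b := e.2) h).1

theorem snd_mem_of_mem_cycleArcs {c : List V} {e : V × V} (h : e ∈ cycleArcs c) : e.2 ∈ c := by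
  simpa using (List.of_mem_zip (a := e.1) (b := e.2) h).2

theorem Subdigraph.IsDicycle.induced_of_mem {X Y : Set V} {c : List V}
    (h : (D.induced X).IsDicycle c) (hY : ∀ x ∈ c, x ∈ Y) : (D.induced Y).IsDicycle c where
  ne_nil := h.ne_nil
  nodup := h.nodup
  verts_mem := hY
  arcs_subset _ he := ⟨(h.arcs_subset he).1, hY _ (fst_mem_of_mem_cycleArcs he),
    hY _ (snd_mem_of_mem_cycleArcs he)⟩

/-- Follow the cycle from `x` round to `y`. This turns monotonicity along arcs into constancy, and
adjacency into mutual reachability. -/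
theorem rel_of_cycleArcs {R : V → V → Prop} (hr : ∀ x, R x x)
    (ht : ∀ x y z, R x y → R y z → R x z) {l : List V}
    (h : ∀ x y, (x, y) ∈ cycleArcs l → R x y) {x y : V} (hx : x ∈ l) (hy : y ∈ l) : R x y := by
  obtain ⟨i, hi, rfl⟩ := List.mem_iff_getElem.1 hx
  obtain ⟨j, hj, rfl⟩ := List.mem_iff_getElem.1 hy
  have hpos : 0 < l.length := by omega
  have key : ∀ k : ℕ, R l[i] (l[(i + k) % l.length]'(Nat.mod_lt _ hpos)) := by
    intro k
    induction k with
    | zero =>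
      have : (i + 0) % l.length = i := by simpa using Nat.mod_eq_of_lt hi
      simp only [this]; exact hr _
    | succ k ih =>
      refine ht _ _ _ ih (h _ _ ?_)
      refine List.mem_iff_getElem.2 ⟨(i + k) % l.length, by simp [Nat.mod_lt _ hpos], ?_⟩
      simp [List.getElem_rotate, Nat.mod_add_mod, add_assoc]
  -- Adding a full turn keeps the subtraction from truncating when `j < i`.
  have := key (l.length + j - i)
  have e : (i + (l.length + j - i)) % l.length = j := by
    rw [show i + (l.length + j - i) = l.length + j by omega, Nat.add_mod_left,
      Nat.mod_eq_of_lt hj]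
  simpa only [e] using this

/-! ### Colourings without monochromatic unbalanced cycles -/

/-- The vertices in `X` can be coloured with `k` colours such that no unbalanced directed cycle of
`D[X]` is monochromatic. -/
def UnbalancedColorable (D : Digraph V) (Z₁ Z₂ : Set (V × V)) (X : Set V) (k : ℕ) : Prop :=
  ∃ c : V → ℕ, (∀ x ∈ X, c x < k) ∧ ∀ l, (D.induced X).IsDicycle l → Unbalanced Z₁ Z₂ l →
    ∃ x ∈ l, ∃ y ∈ l, c x ≠ c y

theorem UnbalancedColorable.subset {X Y : Set V} {k : ℕ} (h : D.UnbalancedColorable Z₁ Z₂ Y k)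
    (hXY : X ⊆ Y) : D.UnbalancedColorable Z₁ Z₂ X k := by
  obtain ⟨c, h1, h2⟩ := h
  exact ⟨c, fun x hx => h1 x (hXY hx),
    fun l hl => h2 l (hl.induced_of_mem fun x hx => hXY (hl.verts_mem x hx))⟩

theorem UnbalancedColorable.mono {X : Set V} {k m : ℕ} (h : D.UnbalancedColorable Z₁ Z₂ X k)
    (hkm : k ≤ m) : D.UnbalancedColorable Z₁ Z₂ X m := by
  obtain ⟨c, h1, h2⟩ := h
  exact ⟨c, fun x hx => (h1 x hx).trans_le hkm, h2⟩

theorem UnbalancedColorable.empty (k : ℕ) : D.UnbalancedColorable Z₁ Z₂ ∅ k := by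
  refine ⟨fun _ => 0, by simp, fun l hl => ?_⟩
  obtain ⟨x, hx⟩ := List.exists_mem_of_ne_nil l hl.ne_nil
  exact (hl.verts_mem x hx).elim

theorem UnbalancedColorable.of_injOn (hD : D.Loopless) {X : Set V} {k : ℕ} (c : V → ℕ)
    (hc : ∀ x ∈ X, c x < k) (hi : Set.InjOn c X) : D.UnbalancedColorable Z₁ Z₂ X k := by
  refine ⟨c, hc, fun l hl _ => ?_⟩
  by_contra! hcon
  obtain ⟨x, hx⟩ := List.exists_mem_of_ne_nil l hl.ne_nil
  have hall : ∀ y ∈ l, y = x := fun y hy =>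
    hi (hl.verts_mem y hy) (hl.verts_mem x hx) (hcon y hy x hx)
  have hlen : l.length = 1 := by
    rw [List.eq_replicate_of_mem hall] at hl hx ⊢
    have := List.nodup_replicate.1 hl.nodup
    have := List.length_pos_of_mem hx
    simp only [List.length_replicate] at *
    omega
  obtain ⟨y, rfl⟩ := List.length_eq_one_iff.1 hlen
  exact hD y (hl.arcs_subset (show (y, y) ∈ cycleArcs [y] by simp [cycleArcs])).1

theorem UnbalancedColorable.union {X Y : Set V} {j k : ℕ}
    (hX : D.UnbalancedColorable Z₁ Z₂ X j) (hY : D.UnbalancedColorable Z₁ Z₂ Y k) :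
    D.UnbalancedColorable Z₁ Z₂ (X ∪ Y) (j + k) := by
  classical
  obtain ⟨c, c1, c2⟩ := hX
  obtain ⟨d, d1, d2⟩ := hY
  refine ⟨fun x => if x ∈ X then c x else j + d x, ?_, ?_⟩
  · intro x hx
    by_cases h : x ∈ X
    · have := c1 x h; simp only [h, if_true]; omega
    · have := d1 x (hx.resolve_left h); simp only [h, if_false]; omega
  · intro l hl hu
    by_contra! hcon
    by_cases h : ∃ x ∈ l, x ∈ X
    · obtain ⟨x, hx, hxX⟩ := h
      have hall : ∀ y ∈ l, y ∈ X := by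
        intro y hy
        by_contra hyX
        have := hcon x hx y hy
        simp only [hxX, hyX, if_true, if_false] at this
        have := c1 x hxX
        omega
      obtain ⟨x, hx, y, hy, hne⟩ := c2 l (hl.induced_of_mem hall) hu
      have := hcon x hx y hy
      simp only [hall x hx, hall y hy, if_true] at this
      exact hne this
    · push Not at h
      obtain ⟨x, hx, y, hy, hne⟩ := d2 l
        (hl.induced_of_mem fun x hx => (hl.verts_mem x hx).resolve_left (h x hx)) hu
      have := hcon x hx y hy
      simp only [h x hx, h y hy, if_false] at this
      omega

/-- Fibres with equal `h` may reuse colours, since no cycle with constant `h ∘ f` meets two of them.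
The pair of `h` and the colour inside the fibre is encoded in base `k`. -/
theorem UnbalancedColorable.of_fibers {ι : Type*} {X : Set V} {m k : ℕ} (f : V → ι) (h : ι → ℕ)
    (hm : ∀ x ∈ X, h (f x) < m)
    (hc : ∀ l, (D.induced X).IsDicycle l → (∀ x ∈ l, ∀ y ∈ l, h (f x) = h (f y)) →
      ∀ x ∈ l, ∀ y ∈ l, f x = f y)
    (hk : ∀ i, D.UnbalancedColorable Z₁ Z₂ (X ∩ f ⁻¹' {i}) k) :
    D.UnbalancedColorable Z₁ Z₂ X (m * k) := by
  choose c c1 c2 using hk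
  have c1' : ∀ x ∈ X, c (f x) x < k := fun x hx => c1 _ x ⟨hx, rfl⟩
  refine ⟨fun x => h (f x) * k + c (f x) x, ?_, ?_⟩
  · intro x hx
    calc h (f x) * k + c (f x) x < h (f x) * k + k := by have := c1' x hx; omega
      _ = (h (f x) + 1) * k := by ring
      _ ≤ m * k := Nat.mul_le_mul_right _ (hm x hx)
  · intro l hl hu
    by_contra! hcon
    have hdiv : ∀ x ∈ X, (h (f x) * k + c (f x) x) / k = h (f x) := by
      intro x hx
      have := c1' x hx
      rw [Nat.mul_comm, Nat.mul_add_div (by omega), Nat.div_eq_of_lt this, add_zero]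
    have hh : ∀ x ∈ l, ∀ y ∈ l, h (f x) = h (f y) := by
      intro x hx y hy
      rw [← hdiv x (hl.verts_mem x hx), ← hdiv y (hl.verts_mem y hy), hcon x hx y hy]
    have hf := hc l hl hh
    obtain ⟨z, hz⟩ := List.exists_mem_of_ne_nil l hl.ne_nil
    obtain ⟨x, hx, y, hy, hne⟩ := c2 (f z) l
      (hl.induced_of_mem fun x hx => ⟨hl.verts_mem x hx, hf x hx z hz⟩) hu
    have := hcon x hx y hy
    rw [hf x hx z hz, hf y hy z hz] at this
    exact hne (by omega)

/-- A minimal non-`j`-colourable set becomes `j`-colourable on losing one vertex, so it costs only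
`j + 1` colours and its complement needs more than `k`. -/
theorem exists_disjoint_not_unbalancedColorable [Finite V] (hD : D.Loopless) {X : Set V}
    {j k : ℕ} (hX : ¬ D.UnbalancedColorable Z₁ Z₂ X (j + 1 + k)) :
    ∃ Y₁ ⊆ X, ∃ Y₂ ⊆ X, Disjoint Y₁ Y₂ ∧ ¬ D.UnbalancedColorable Z₁ Z₂ Y₁ j ∧
      ¬ D.UnbalancedColorable Z₁ Z₂ Y₂ k := by
  obtain ⟨Y, ⟨hYX, hY⟩, hmin⟩ := wellFounded_lt.has_min
    {Y : Set V | Y ⊆ X ∧ ¬ D.UnbalancedColorable Z₁ Z₂ Y j}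
    ⟨X, subset_rfl, fun h => hX (h.mono (by omega))⟩
  refine ⟨Y, hYX, X \ Y, Set.sdiff_subset, Set.disjoint_sdiff_right, hY, fun h => hX ?_⟩
  obtain ⟨v, hv⟩ : Y.Nonempty := by
    rw [Set.nonempty_iff_ne_empty]
    rintro rfl
    exact hY (.empty _)
  have h1 : D.UnbalancedColorable Z₁ Z₂ (Y \ {v}) j := by
    by_contra h1
    exact hmin _ ⟨Set.sdiff_subset.trans hYX, h1⟩ (Set.sdiff_singleton_ssubset.2 hv)
  have h2 : D.UnbalancedColorable Z₁ Z₂ {v} 1 :=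
    .of_injOn hD (fun _ => 0) (by simp) (by simp)
  refine ((h1.union h2).union h).subset fun x hx => ?_
  by_cases hxY : x ∈ Y
  · by_cases hxv : x = v
    · exact .inl (.inr hxv)
    · exact .inl (.inl ⟨hxY, hxv⟩)
  · exact .inr ⟨hx, hxY⟩

/-- Layers of equal parity share colours: on a cycle of constant parity `f` cannot change by one in
the bounded direction, so it is monotone round the cycle and hence constant. -/
theorem exists_layer_not_unbalancedColorable {X : Set V} {k : ℕ}
    (hX : ¬ D.UnbalancedColorable Z₁ Z₂ X (2 * k)) (f : V → ℕ)
    (hf : (∀ a ∈ X, ∀ b ∈ X, D.Adj a b → f b ≤ f a + 1) ∨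
      (∀ a ∈ X, ∀ b ∈ X, D.Adj a b → f a ≤ f b + 1)) :
    ∃ n, ¬ D.UnbalancedColorable Z₁ Z₂ (X ∩ f ⁻¹' {n}) k := by
  by_contra! hcon
  refine hX (.of_fibers f (· % 2) (fun x _ => Nat.mod_lt _ (by omega)) ?_ hcon)
  intro l hl hpar
  rcases hf with hf | hf
  · have : ∀ x ∈ l, ∀ y ∈ l, f y ≤ f x := fun x hx y hy =>
      rel_of_cycleArcs (R := fun a b => f b ≤ f a) (fun _ => le_rfl)
        (fun _ _ _ h1 h2 => h2.trans h1) (fun a b hab => by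
          obtain ⟨h1, h2, h3⟩ := hl.arcs_subset hab
          have := hf a h2 b h3 h1
          have := hpar a (fst_mem_of_mem_cycleArcs hab) b (snd_mem_of_mem_cycleArcs hab)
          omega) hx hy
    exact fun x hx y hy => le_antisymm (this y hy x hx) (this x hx y hy)
  · have : ∀ x ∈ l, ∀ y ∈ l, f x ≤ f y := fun x hx y hy =>
      rel_of_cycleArcs (R := fun a b => f a ≤ f b) (fun _ => le_rfl)
        (fun _ _ _ h1 h2 => h1.trans h2) (fun a b hab => by
          obtain ⟨h1, h2, h3⟩ := hl.arcs_subset hab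
          have := hf a h2 b h3 h1
          have := hpar a (fst_mem_of_mem_cycleArcs hab) b (snd_mem_of_mem_cycleArcs hab)
          omega) hx hy
    exact fun x hx y hy => le_antisymm (this x hx y hy) (this y hy x hx)

/-- Adjacency in the subdigraph induced by `X`. -/
def AdjIn (D : Digraph V) (X : Set V) (a b : V) : Prop := a ∈ X ∧ b ∈ X ∧ D.Adj a b

/-- Every cycle lies in one strong component, so all components can use the same colours. -/
theorem exists_stronglyConnected_not_unbalancedColorable {X : Set V} {k : ℕ}
    (hX : ¬ D.UnbalancedColorable Z₁ Z₂ X k) :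
    ∃ Y ⊆ X, ¬ D.UnbalancedColorable Z₁ Z₂ Y k ∧
      ∀ a ∈ Y, ∀ b ∈ Y, ReflTransGen (D.AdjIn X) a b := by
  by_contra! hcon
  have key := UnbalancedColorable.of_fibers (D := D) (Z₁ := Z₁) (Z₂ := Z₂) (X := X) (m := 1)
    (k := k)
    (fun x => {y | ReflTransGen (D.AdjIn X) x y ∧ ReflTransGen (D.AdjIn X) y x}) (fun _ => 0)
    (by simp) ?_ ?_
  · exact hX (by simpa using key)
  · intro l hl _ x hx y hy
    have hr : ∀ x ∈ l, ∀ y ∈ l, ReflTransGen (D.AdjIn X) x y := fun x hx y hy =>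
      rel_of_cycleArcs (fun _ => .refl) (fun _ _ _ => .trans)
        (fun a b hab => .single (by
          obtain ⟨h1, h2, h3⟩ := hl.arcs_subset hab
          exact ⟨h2, h3, h1⟩)) hx hy
    ext z
    exact ⟨fun h => ⟨(hr y hy x hx).trans h.1, h.2.trans (hr x hx y hy)⟩,
      fun h => ⟨(hr x hx y hy).trans h.1, h.2.trans (hr y hy x hx)⟩⟩
  · intro i
    by_contra h
    obtain ⟨a, ha, b, hb, hab⟩ := hcon _ Set.inter_subset_left h
    have hb' : b ∈ i := by
      rw [← (show _ = i from hb.2)]; exact ⟨.refl, .refl⟩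
    rw [← (show _ = i from ha.2)] at hb'
    exact hab hb'.1

/-! ### Paths -/

/-- The list `p` is the vertex sequence of a path from `u` to `v` with steps in the relation `r`. -/
structure IsRelPath (r : V → V → Prop) (u v : V) (p : List V) : Prop where
  nodup : p.Nodup
  head_eq : p.head? = some u
  last_eq : p.getLast? = some v
  chain : p.IsChain r

theorem IsRelPath.singleton (r : V → V → Prop) (u : V) : IsRelPath r u u [u] :=
  ⟨by simp, by simp, by simp, by simp⟩

theorem IsRelPath.imp {r s : V → V → Prop} {u v : V} {p : List V} (h : IsRelPath r u v p)
    (hrs : ∀ a b, a ∈ p → b ∈ p → r a b → s a b) : IsRelPath s u v p :=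
  ⟨h.nodup, h.head_eq, h.last_eq, h.chain.imp_of_mem_imp fun a b ha hb => hrs a b ha hb⟩

theorem IsRelPath.reflTransGen {r : V → V → Prop} {u v : V} {p : List V}
    (h : IsRelPath r u v p) : ReflTransGen r u v := by
  have hne : p ≠ [] := by rintro rfl; simpa using h.head_eq
  have := List.relationReflTransGen_of_exists_isChain p h.chain hne
  rwa [List.head_of_head?_eq_some h.head_eq, List.getLast_of_getLast?_eq_some h.last_eq] at this

theorem IsRelPath.append {r : V → V → Prop} {u v w : V} {p q : List V}
    (hp : IsRelPath r u v p) (hq : IsRelPath r v w (v :: q)) (hd : ∀ x ∈ p, x ∉ q) :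
    IsRelPath r u w (p ++ q) where
  nodup := List.nodup_append'.2 ⟨hp.nodup, (List.nodup_cons.1 hq.nodup).2,
    fun x hx hx' => hd x hx hx'⟩
  head_eq := by simp [hp.head_eq]
  last_eq := by
    have := hq.last_eq
    rw [List.getLast?_append, hp.last_eq]
    rw [List.getLast?_cons] at this
    cases h : q.getLast? <;> simp_all
  chain := by
    have := hq.chain
    refine List.isChain_append.2 ⟨hp.chain, this.tail, ?_⟩
    intro x hx y hy
    rw [hp.last_eq] at hx
    cases q with
    | nil => simp at hy
    | cons z q =>
      simp only [List.head?_cons, Option.mem_def, Option.some.injEq] at hx hy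
      subst hx hy
      exact (List.isChain_cons_cons.1 this).1

/-- `v` can be reached from `u` in exactly `n` steps of the relation `r`. -/
def ReachIn (r : V → V → Prop) (u : V) : ℕ → V → Prop
  | 0, v => v = u
  | n + 1, v => ∃ w, ReachIn r u n w ∧ r w v

theorem exists_reachIn {r : V → V → Prop} {u v : V} (h : ReflTransGen r u v) :
    ∃ n, ReachIn r u n v := by
  induction h with
  | refl => exact ⟨0, rfl⟩
  | tail _ hr ih => obtain ⟨n, hn⟩ := ih; exact ⟨n + 1, _, hn, hr⟩

/-- Breadth-first search from `u`. -/
theorem exists_level (r : V → V → Prop) (u : V) : ∃ f : V → ℕ,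
    (∀ a b, ReflTransGen r u a → r a b → f b ≤ f a + 1) ∧
    ∀ v, ReflTransGen r u v → ∃ p, IsRelPath r u v p ∧ ∀ x ∈ p, x = v ∨ f x < f v := by
  have hle : ∀ n v, ReachIn r u n v → sInf {n | ReachIn r u n v} ≤ n := fun n v h => Nat.sInf_le h
  have hmem : ∀ v, ReflTransGen r u v → ReachIn r u (sInf {n | ReachIn r u n v}) v :=
    fun v h => Nat.sInf_mem (exists_reachIn h)
  have hstep : ∀ a b, ReachIn r u (sInf {n | ReachIn r u n a}) a → r a b →
      sInf {n | ReachIn r u n b} ≤ sInf {n | ReachIn r u n a} + 1 :=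
    fun a b ha hab => hle _ _ ⟨a, ha, hab⟩
  -- Unreachable vertices get the junk level `sInf ∅ = 0`; both clauses concern reachable vertices
  -- only.
  refine ⟨fun v => sInf {n | ReachIn r u n v}, fun a b ha => hstep a b (hmem a ha), ?_⟩
  have key : ∀ n v, sInf {n | ReachIn r u n v} = n → ReachIn r u n v →
      ∃ p, IsRelPath r u v p ∧
        ∀ x ∈ p, x = v ∨ sInf {n | ReachIn r u n x} < sInf {n | ReachIn r u n v} := by
    intro n
    induction n with
    | zero =>
      rintro v - rfl
      exact ⟨[v], .singleton r v, by simp⟩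
    | succ n ih =>
      rintro v hv ⟨w, hw, hwv⟩
      have h1 : sInf {n | ReachIn r u n w} = n := by
        refine le_antisymm (hle _ _ hw) ?_
        have := hstep w v (Nat.sInf_mem (s := {n | ReachIn r u n w}) ⟨n, hw⟩) hwv
        omega
      obtain ⟨p, hp, hlt⟩ := ih w h1 hw
      have hlt' : ∀ x ∈ p, sInf {n | ReachIn r u n x} < sInf {n | ReachIn r u n v} := by
        intro x hx
        rcases hlt x hx with rfl | h <;> omega
      have hvp : v ∉ p := fun h => lt_irrefl _ (hlt' v h)
      refine ⟨p ++ [v], hp.append ⟨?_, by simp, by simp, by simpa using hwv⟩ ?_, ?_⟩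
      · have : w ≠ v := by rintro rfl; omega
        simpa using this
      · intro x hx h
        rw [List.mem_singleton] at h
        exact hvp (h ▸ hx)
      · intro x hx
        rcases List.mem_append.1 hx with h | h
        · exact .inr (hlt' x h)
        · exact .inl (by simpa using h)
  exact fun v hv => key _ v rfl (hmem v hv)

theorem IsRelPath.mem_of_adjIn {X : Set V} {u v : V} {p : List V} (hu : u ∈ X)
    (h : IsRelPath (D.AdjIn X) u v p) : ∀ x ∈ p, x ∈ X := by
  obtain ⟨-, h1, -, h2⟩ := h
  cases p with
  | nil => simp
  | cons a p =>
    obtain rfl : a = u := by simpa using h1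
    clear h1
    induction p generalizing a with
    | nil => simpa using hu
    | cons b p ih =>
      rw [List.isChain_cons_cons] at h2
      rintro x (_ | ⟨_, hx⟩)
      · exact hu
      · exact ih b h2.2 h2.1.2.1 x hx

/-! ### Weights of paths -/

variable {G : Type*} [AddCommGroup G]

/-- The sum of the weights of the pairs of consecutive entries. -/
def pathWeight (w : V → V → G) : List V → G
  | [] => 0
  | [_] => 0
  | a :: b :: l => w a b + pathWeight w (b :: l)

theorem pathWeight_append (w : V → V → G) {y : V} (q : List V) :
    ∀ {p : List V}, p.getLast? = some y →
      pathWeight w (p ++ q) = pathWeight w p + pathWeight w (y :: q)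
  | [], h => by simp at h
  | [a], h => by
    obtain rfl : a = y := by simpa using h
    simp [pathWeight]
  | a :: b :: l, h => by
    have := pathWeight_append w q (p := b :: l) (by simpa using h)
    simp only [List.cons_append, pathWeight] at this ⊢
    rw [this, add_assoc]

/-- There is a directed path of weight `g` from `x` to `y` all of whose vertices lie in `A`. -/
def Linked (D : Digraph V) (w : V → V → G) (A : Set V) (x y : V) (g : G) : Prop :=
  ∃ p, IsRelPath D.Adj x y p ∧ (∀ v ∈ p, v ∈ A) ∧ pathWeight w p = g

variable {w : V → V → G}

theorem Linked.mono {A B : Set V} {x y : V} {g : G} (h : D.Linked w A x y g) (hAB : A ⊆ B) :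
    D.Linked w B x y g := by
  obtain ⟨p, h1, h2, h3⟩ := h
  exact ⟨p, h1, fun v hv => hAB (h2 v hv), h3⟩

theorem Linked.refl {A : Set V} {x : V} (hx : x ∈ A) : D.Linked w A x x 0 :=
  ⟨[x], .singleton _ x, by simpa using hx, rfl⟩

/-- The regions meet at most in `y`, so the concatenation repeats no vertex. -/
theorem Linked.trans {A B : Set V} {x y z : V} {g h : G} (h1 : D.Linked w A x y g)
    (h2 : D.Linked w B y z h) (hAB : ∀ v ∈ A, v ∈ B → v = y) :
    D.Linked w (A ∪ B) x z (g + h) := by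
  obtain ⟨p, hp, hpA, rfl⟩ := h1
  obtain ⟨q, hq, hqB, rfl⟩ := h2
  cases q with
  | nil => simpa using hq.head_eq
  | cons a q =>
    obtain rfl : a = y := by simpa using hq.head_eq
    refine ⟨p ++ q, hp.append hq ?_, ?_, pathWeight_append w q hp.last_eq⟩
    · intro x hx hxq
      have := hAB x (hpA x hx) (hqB x (by simp [hxq]))
      subst this
      exact (List.nodup_cons.1 hq.nodup).1 hxq
    · intro x hx
      rcases List.mem_append.1 hx with h | h
      · exact .inl (hpA x h)
      · exact .inr (hqB x (by simp [h]))

theorem exists_linked_of_reflTransGen {X : Set V} {x y : V} (hx : x ∈ X)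
    (h : ReflTransGen (D.AdjIn X) x y) : ∃ g, D.Linked w X x y g := by
  obtain ⟨f, -, hf⟩ := exists_level (D.AdjIn X) x
  obtain ⟨p, hp, -⟩ := hf y h
  exact ⟨_, p, hp.imp fun _ _ _ _ h => h.2.2, hp.mem_of_adjIn hx, rfl⟩

/-! ### Linking outside a large set -/

/-- Go from `x` to a root `u` along an in-search path and on to `y` along an out-search path. Only
the end of a search path lies in its layer, so both avoid the intersection `J` of the two layers
except at `x` and `y`. Each layering costs a factor 2. -/
theorem exists_linking {X : Set V} {k : ℕ} (w : V → V → G)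
    (hX : ¬ D.UnbalancedColorable Z₁ Z₂ X (4 * k)) :
    ∃ J ⊆ X, ¬ D.UnbalancedColorable Z₁ Z₂ J k ∧
      ∀ x ∈ J, ∀ y ∈ J, x ≠ y → ∃ g, D.Linked w ((X \ J) ∪ {x, y}) x y g := by
  obtain ⟨C, hCX, hC, hconn⟩ := exists_stronglyConnected_not_unbalancedColorable hX
  obtain ⟨u, hu⟩ : C.Nonempty := by
    rw [Set.nonempty_iff_ne_empty]
    rintro rfl
    exact hC (.empty _)
  obtain ⟨f, f1, f2⟩ := exists_level (D.AdjIn X) u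
  obtain ⟨g, g1, g2⟩ := exists_level (Function.swap (D.AdjIn X)) u
  have hswap : ∀ a ∈ C, ReflTransGen (Function.swap (D.AdjIn X)) u a := fun a ha =>
    reflTransGen_swap.2 (hconn a ha u hu)
  rw [show 4 * k = 2 * (2 * k) by ring] at hC
  obtain ⟨m, hm⟩ := exists_layer_not_unbalancedColorable hC f
    (.inl fun a ha b hb hab => f1 a b (hconn u hu a ha) ⟨hCX ha, hCX hb, hab⟩)
  obtain ⟨n, hn⟩ := exists_layer_not_unbalancedColorable hm g
    (.inr fun a ha b hb hab => g1 b a (hswap b hb.1) ⟨hCX ha.1, hCX hb.1, hab⟩)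
  refine ⟨_, fun x hx => hCX hx.1.1, hn, ?_⟩
  rintro x ⟨⟨hxC, hxm⟩, hxn⟩ y ⟨⟨hyC, hym⟩, hyn⟩ -
  simp only [Set.mem_preimage, Set.mem_singleton_iff] at hxm hxn hym hyn
  refine exists_linked_of_reflTransGen (by simp) ?_
  have hxu : ReflTransGen (D.AdjIn (X \ (C ∩ f ⁻¹' {m} ∩ g ⁻¹' {n}) ∪ {x, y})) x u := by
    obtain ⟨p, hp, hlt⟩ := g2 x (hswap x hxC)
    -- The in-search path is a path of the reversed digraph.
    have hpX : ∀ v ∈ p, v ∈ X :=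
      (hp.imp (s := (Digraph.mk fun a b => D.Adj b a).AdjIn X)
        fun a b _ _ h => ⟨h.2.1, h.1, h.2.2⟩).mem_of_adjIn (hCX hu)
    have hT : ∀ v ∈ p, v ∈ X \ (C ∩ f ⁻¹' {m} ∩ g ⁻¹' {n}) ∪ {x, y} := by
      intro v hv
      rcases hlt v hv with rfl | h
      · simp
      · exact .inl ⟨hpX v hv, fun h' => by
          have : g v = n := h'.2
          omega⟩
    exact reflTransGen_swap.1
      (hp.imp fun a b ha hb hab => ⟨hT b hb, hT a ha, hab.2.2⟩).reflTransGen
  have huy : ReflTransGen (D.AdjIn (X \ (C ∩ f ⁻¹' {m} ∩ g ⁻¹' {n}) ∪ {x, y})) u y := by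
    obtain ⟨p, hp, hlt⟩ := f2 y (hconn u hu y hyC)
    have hT : ∀ v ∈ p, v ∈ X \ (C ∩ f ⁻¹' {m} ∩ g ⁻¹' {n}) ∪ {x, y} := by
      intro v hv
      rcases hlt v hv with rfl | h
      · simp
      · exact .inl ⟨hp.mem_of_adjIn (hCX hu) v hv, fun h' => by
          have : f v = m := h'.1.2
          omega⟩
    exact (hp.imp fun a b ha hb hab => ⟨hT a ha, hT b hb, hab.2.2⟩).reflTransGen
  exact hxu.trans huy

/-! ### Paths of different weights -/

variable [Finite G]

theorem exists_linked_sub_notMem (hD : D.Loopless) {X : Set V} {H : AddSubgroup G}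
    (hw : ∀ u v, w u v ∈ H → ((u, v) ∈ Z₁ ↔ (u, v) ∈ Z₂))
    (hX : ¬ D.UnbalancedColorable Z₁ Z₂ X (2 * Nat.card G)) :
    ∃ s ∈ X, ∃ t ∈ X, ∃ g₁ g₂, D.Linked w X s t g₁ ∧ D.Linked w X s t g₂ ∧ g₁ - g₂ ∉ H := by
  obtain ⟨C, hCX, hC, hconn⟩ := exists_stronglyConnected_not_unbalancedColorable hX
  obtain ⟨u, hu⟩ : C.Nonempty := by
    rw [Set.nonempty_iff_ne_empty]
    rintro rfl
    exact hC (.empty _)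
  obtain ⟨f, f1, f2⟩ := exists_level (D.AdjIn X) u
  obtain ⟨m, hm⟩ := exists_layer_not_unbalancedColorable hC f
    (.inl fun a ha b hb hab => f1 a b (hconn u hu a ha) ⟨hCX ha, hCX hb, hab⟩)
  by_contra! hcon
  choose! p hp hlt using fun v (hv : v ∈ C) => f2 v (hconn u hu v hv)
  -- The colour of a vertex is the weight of its search path.
  refine hm ⟨fun v => Finite.equivFin G (pathWeight w (p v)), fun x _ => Fin.is_lt _, ?_⟩
  intro l hl hunb
  by_contra! hmono
  refine hunb (congrArg Set.ncard (Set.ext fun ⟨a, b⟩ => and_congr_right fun hab => ?_))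
  obtain ⟨h1, ⟨haC, ham⟩, hbC, hbm⟩ := hl.arcs_subset hab
  replace h1 : D.Adj a b := h1
  simp only [Set.mem_preimage, Set.mem_singleton_iff] at haC ham hbC hbm
  have hpw : pathWeight w (p a) = pathWeight w (p b) := by
    have := hmono a (fst_mem_of_mem_cycleArcs hab) b (snd_mem_of_mem_cycleArcs hab)
    exact (Finite.equivFin G).injective (Fin.ext this)
  have hne : a ≠ b := by rintro rfl; exact hD a h1
  have hapX : ∀ v ∈ p a, v ∈ X := (hp a haC).mem_of_adjIn (hCX hu)
  have hb' : b ∉ p a := by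
    intro h
    rcases hlt a haC b h with h | h
    · exact hne h.symm
    · omega
  have happ : IsRelPath D.Adj u b (p a ++ [b]) := by
    refine ((hp a haC).imp fun _ _ _ _ h => h.2.2).append
      ⟨by simpa using hne, by simp, by simp, by simpa using h1⟩ ?_
    intro x hx h
    rw [List.mem_singleton] at h
    exact hb' (h ▸ hx)
  -- Compare `p a` extended by the arc `(a, b)` with `p b`: the weights differ by exactly `w a b`.
  have := hcon u (hCX hu) b (hCX hbC) _ _ ⟨_, happ, by
      intro v hv
      rcases List.mem_append.1 hv with h | h
      · exact hapX v h
      · rw [List.mem_singleton.1 h]; exact hCX hbC, rfl⟩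
    ⟨p b, (hp b hbC).imp fun _ _ _ _ h => h.2.2, (hp b hbC).mem_of_adjIn (hCX hu), rfl⟩
  rw [pathWeight_append w [b] (hp a haC).last_eq, hpw, add_sub_cancel_left] at this
  exact hw a b (by simpa [pathWeight] using this)

/-! ### Paths of all weights -/

/-- If the unbalanced dichromatic number is at least this bound, then there are two vertices that
are joined by paths of more than `k`, or else of all weights. -/
def blockBound (n : ℕ) : ℕ → ℕ
  | 0 => 0
  | k + 1 => 4 * (blockBound n k + 1 + 2 * n)

-- Two paths whose weights differ modulo the stabilizer of `S`, chained after the paths for `S`,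
-- give two distinct translates of `S`, whose union is larger than `S`.
open scoped Pointwise in
theorem exists_linked_weights [Finite V] (hD : D.Loopless)
    (hw : ∀ H : AddSubgroup G, H ≠ ⊤ → ∀ u v, w u v ∈ H → ((u, v) ∈ Z₁ ↔ (u, v) ∈ Z₂))
    (k : ℕ) {X : Set V} (hX : ¬ D.UnbalancedColorable Z₁ Z₂ X (blockBound (Nat.card G) k)) :
    ∃ s ∈ X, ∃ t ∈ X, ∃ S : Set G, (k + 1 ≤ S.ncard ∨ S = Set.univ) ∧
      ∀ g ∈ S, D.Linked w X s t g := by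
  induction k generalizing X with
  | zero =>
    obtain ⟨s, hs⟩ : X.Nonempty := by
      rw [Set.nonempty_iff_ne_empty]
      rintro rfl
      exact hX (.empty _)
    exact ⟨s, hs, s, hs, {0}, by simp, by rintro g rfl; exact .refl hs⟩
  | succ k ih =>
    -- The factor 4 pays for the connecting path outside `X₁`; the summands pay for the old block
    -- `Y₁` and the new pair of paths in `Y₂`.
    obtain ⟨X₁, hX₁, hcol, hlink⟩ := exists_linking w hX
    obtain ⟨Y₁, hY₁, Y₂, hY₂, hdisj, hcol₁, hcol₂⟩ :=
      exists_disjoint_not_unbalancedColorable hD hcol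
    obtain ⟨s, hs, t, ht, S, hS, hst⟩ := ih hcol₁
    by_cases hu : S = Set.univ
    · exact ⟨s, hX₁ (hY₁ hs), t, hX₁ (hY₁ ht), S, .inr hu,
        fun g hg => (hst g hg).mono (hY₁.trans hX₁)⟩
    replace hS := hS.resolve_right hu
    have hH : AddAction.stabilizer G S ≠ ⊤ := by
      intro htop
      obtain ⟨a, ha⟩ := Set.nonempty_of_ncard_ne_zero (s := S) (by omega)
      refine hu (Set.eq_univ_of_forall fun g => ?_)
      have : g - a ∈ AddAction.stabilizer G S := htop ▸ AddSubgroup.mem_top _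
      rw [AddAction.mem_stabilizer_iff] at this
      rw [← this]
      exact ⟨a, ha, by simp⟩
    obtain ⟨s', hs', t', ht', g₁, g₂, hg₁, hg₂, hg⟩ :=
      exists_linked_sub_notMem (w := w) hD (hw _ hH) hcol₂
    obtain ⟨c, hc⟩ := hlink t (hY₁ ht) s' (hY₂ hs') (hdisj.ne_of_mem ht hs')
    have hnot : ∀ v ∈ Y₁, v ∉ Y₂ := fun v h1 h2 => hdisj.ne_of_mem h1 h2 rfl
    have hlinks : ∀ g ∈ S, ∀ g', D.Linked w Y₂ s' t' g' →
        D.Linked w X s t' (g' + c + g) := by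
      intro g hg g' hg'
      rw [show g' + c + g = g + c + g' by abel]
      refine (((hst g hg).trans hc ?_).trans hg' ?_).mono ?_
      · rintro v hv (h | rfl | rfl)
        · exact (h.2 (hY₁ hv)).elim
        · rfl
        · exact (hnot _ hv hs').elim
      · rintro v (h | h | rfl | rfl) hv
        · exact (hnot v h hv).elim
        · exact (h.2 (hY₂ hv)).elim
        · exact (hnot _ ht hv).elim
        · rfl
      · rintro v ((h | h | rfl | rfl) | h)
        exacts [hX₁ (hY₁ h), h.1, hX₁ (hY₁ ht), hX₁ (hY₂ hs'), hX₁ (hY₂ h)]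
    refine ⟨s, hX₁ (hY₁ hs), t', hX₁ (hY₂ ht'), ((g₁ + c) +ᵥ S) ∪ ((g₂ + c) +ᵥ S), .inl ?_, ?_⟩
    -- Without growth both translates equal their union, so `g₁ - g₂` stabilizes `S`.
    · by_contra! hlt
      have hcard : ∀ a : G, (a +ᵥ S).ncard = S.ncard := fun a =>
        Set.ncard_image_of_injective _ (AddAction.injective a)
      have e₁ := Set.eq_of_subset_of_ncard_le
        (Set.subset_union_left : (g₁ + c) +ᵥ S ⊆ ((g₁ + c) +ᵥ S) ∪ ((g₂ + c) +ᵥ S))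
        (by rw [hcard]; omega) (Set.toFinite _)
      have e₂ := Set.eq_of_subset_of_ncard_le
        (Set.subset_union_right : (g₂ + c) +ᵥ S ⊆ ((g₁ + c) +ᵥ S) ∪ ((g₂ + c) +ᵥ S))
        (by rw [hcard]; omega) (Set.toFinite _)
      apply hg
      rw [AddAction.mem_stabilizer_iff, show g₁ - g₂ = -(g₂ + c) + (g₁ + c) by abel, add_vadd,
        e₁.trans e₂.symm, neg_vadd_vadd]
    · rintro _ (⟨g, hg, rfl⟩ | ⟨g, hg, rfl⟩)
      · exact hlinks g hg g₁ hg₁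
      · exact hlinks g hg g₂ hg₂

/-- Detour through a block `Y` having paths of all weights: `x` to `s` outside `X₁`, `s` to `t` in
`Y`, `t` to `y` in `X₁` outside `X₂`, apart from ends. Two nested linkings keep the outer pieces
disjoint. -/
theorem exists_linking_all_weights [Finite V] (hD : D.Loopless)
    (hw : ∀ H : AddSubgroup G, H ≠ ⊤ → ∀ u v, w u v ∈ H → ((u, v) ∈ Z₁ ↔ (u, v) ∈ Z₂))
    {k : ℕ} {X : Set V} (hX : ¬ D.UnbalancedColorable Z₁ Z₂ X
      (4 * (4 * (blockBound (Nat.card G) (Nat.card G) + 1 + k)))) :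
    ∃ J ⊆ X, ¬ D.UnbalancedColorable Z₁ Z₂ J k ∧
      ∀ x ∈ J, ∀ y ∈ J, x ≠ y → ∀ g, D.Linked w ((X \ J) ∪ {x, y}) x y g := by
  obtain ⟨X₁, hX₁, hcol₁, hlink₁⟩ := exists_linking w hX
  obtain ⟨X₂, hX₂, hcol₂, hlink₂⟩ := exists_linking w hcol₁
  obtain ⟨Y, hY, J, hJ, hdisj, hcolY, hcolJ⟩ := exists_disjoint_not_unbalancedColorable hD hcol₂
  obtain ⟨s, hs, t, ht, S, hS, hst⟩ := exists_linked_weights hD hw _ hcolY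
  have hS : S = Set.univ := hS.resolve_left fun h => by
    have := Set.ncard_le_ncard (Set.subset_univ S)
    rw [Set.ncard_univ] at this
    omega
  refine ⟨J, hJ.trans (hX₂.trans hX₁), hcolJ, fun x hx y hy hxy g => ?_⟩
  have hnot : ∀ v ∈ Y, v ∉ J := fun v h1 h2 => hdisj.ne_of_mem h1 h2 rfl
  obtain ⟨c, hc⟩ := hlink₁ x (hX₂ (hJ hx)) s (hX₂ (hY hs)) (hdisj.ne_of_mem hs hx).symm
  obtain ⟨d, hd⟩ := hlink₂ t (hY ht) y (hJ hy) (hdisj.ne_of_mem ht hy)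
  -- The block supplies whatever the two connecting paths leave missing.
  have hg := hst (g - c - d) (hS ▸ Set.mem_univ _)
  rw [show g = c + (g - c - d) + d by abel]
  refine ((hc.trans hg ?_).trans hd ?_).mono ?_
  · rintro v (h | rfl | rfl) hv
    · exact (h.2 (hX₂ (hY hv))).elim
    · exact (hnot _ hv hx).elim
    · rfl
  · rintro v ((h | rfl | rfl) | h) (h' | rfl | rfl)
    · exact (h.2 h'.1).elim
    · exact (h.2 (hX₂ (hY ht))).elim
    · exact (h.2 (hX₂ (hJ hy))).elim
    · exact (h'.2 (hJ hx)).elim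
    · rfl
    · exact (hxy rfl).elim
    · exact (h'.2 (hY hs)).elim
    · rfl
    · exact (hnot _ hs hy).elim
    · exact (h'.2 (hY h)).elim
    · rfl
    · exact (hnot _ h hy).elim
  · have hYX : ∀ v ∈ Y, v ∈ X \ J := fun v hv => ⟨hX₁ (hX₂ (hY hv)), hnot v hv⟩
    rintro v (((h | rfl | rfl) | h) | (h | rfl | rfl))
    · exact .inl ⟨h.1, fun h' => h.2 (hX₂ (hJ h'))⟩
    · simp
    · exact .inl (hYX _ hs)
    · exact .inl (hYX v h)
    · exact .inl ⟨hX₁ h.1, fun h' => h.2 (hJ h')⟩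
    · exact .inl (hYX _ ht)
    · simp

end Digraph

namespace Digraph

variable {V : Type*} {D : Digraph V} {Z₁ Z₂ : Set (V × V)}

/-! ### Arcs of a path -/

theorem pathArcs_cons_cons (a b : V) (l : List V) :
    pathArcs (a :: b :: l) = insert (a, b) (pathArcs (b :: l)) := by
  ext e
  simp [pathArcs]

theorem mem_of_mem_pathArcs {p : List V} {e : V × V} (h : e ∈ pathArcs p) : e.1 ∈ p ∧ e.2 ∈ p := by
  have := List.of_mem_zip (a := e.1) (b := e.2) h
  exact ⟨this.1, List.mem_of_mem_tail this.2⟩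

theorem finite_pathArcs (p : List V) : (pathArcs p).Finite := List.finite_toSet _

theorem pathArcs_subset_of_isChain : ∀ {p : List V}, p.IsChain D.Adj → pathArcs p ⊆ D.arcs
  | [], _ => by simp [pathArcs]
  | [_], _ => by simp [pathArcs]
  | a :: b :: l, h => by
    rw [List.isChain_cons_cons] at h
    rw [pathArcs_cons_cons, Set.insert_subset_iff]
    exact ⟨h.1, pathArcs_subset_of_isChain h.2⟩

theorem ncard_pathArcs_cons_cons_inter (Z : Set (V × V)) [DecidablePred (· ∈ Z)] {a b : V}
    {l : List V} (h : (a :: b :: l).Nodup) :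
    (pathArcs (a :: b :: l) ∩ Z).ncard =
      (if (a, b) ∈ Z then 1 else 0) + (pathArcs (b :: l) ∩ Z).ncard := by
  rw [pathArcs_cons_cons]
  split_ifs with hab
  · rw [Set.insert_inter_of_mem hab, Set.ncard_insert_of_notMem _
      ((finite_pathArcs _).subset Set.inter_subset_left), add_comm]
    exact fun h' => (List.nodup_cons.1 h).1 (mem_of_mem_pathArcs h'.1).1
  · rw [Set.insert_inter_of_notMem hab, zero_add]

open scoped Classical in
/-- The weight of an arc that counts the membership in `Z₁` and `Z₂` with coefficients `a`, `b`. -/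
noncomputable def arcWeight (Z₁ Z₂ : Set (V × V)) {R : Type*} [Ring R] (a b : R) (u v : V) : R :=
  (if (u, v) ∈ Z₁ then a else 0) + if (u, v) ∈ Z₂ then b else 0

/-- `pathArcs` is a set, so counting it agrees with summing along the list because no arc repeats.
-/
theorem pathWeight_arcWeight {R : Type*} [Ring R] (a b : R) : ∀ {p : List V}, p.Nodup →
    pathWeight (arcWeight Z₁ Z₂ a b) p =
      a * ((pathArcs p ∩ Z₁).ncard : R) + b * ((pathArcs p ∩ Z₂).ncard : R)
  | [], _ => by simp [pathWeight, pathArcs]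
  | [_], _ => by simp [pathWeight, pathArcs]
  | x :: y :: l, h => by
    classical
    rw [pathWeight, pathWeight_arcWeight a b (List.nodup_cons.1 h).2,
      ncard_pathArcs_cons_cons_inter Z₁ h, ncard_pathArcs_cons_cons_inter Z₂ h, arcWeight]
    push_cast
    split_ifs <;> simp [mul_add] <;> abel

/-- A unit generates the additive group of `ZMod n`, so a proper subgroup contains neither `a` nor
`b`, the weights of arcs in exactly one of the two sets. -/
theorem arcWeight_mem_iff {n : ℕ} {a b : ZMod n} (ha : IsUnit a) (hb : IsUnit b)
    {H : AddSubgroup (ZMod n)} (hH : H ≠ ⊤) (u v : V) (h : arcWeight Z₁ Z₂ a b u v ∈ H) :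
    (u, v) ∈ Z₁ ↔ (u, v) ∈ Z₂ := by
  have key : ∀ c : ZMod n, IsUnit c → c ∉ H := by
    intro c hc hcH
    refine hH ((AddSubgroup.eq_top_iff' _).2 fun x => ?_)
    obtain ⟨d, hd⟩ := hc.exists_left_inv
    obtain ⟨m, hm⟩ := ZMod.intCast_surjective (x * d)
    have := H.zsmul_mem hcH m
    rwa [zsmul_eq_mul, hm, mul_assoc, hd, mul_one] at this
  unfold arcWeight at h
  by_cases h1 : (u, v) ∈ Z₁ <;> by_cases h2 : (u, v) ∈ Z₂ <;> simp only [h1, h2, if_true, if_false]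
      at h ⊢
  · exact (key a ha (by simpa using h)).elim
  · exact (key b hb (by simpa using h)).elim

theorem IsRelPath.ne_of_mem_internalVerts {r : V → V → Prop} {x y v : V} {p : List V}
    (h : IsRelPath r x y p) (hv : v ∈ internalVerts p) : v ∈ p ∧ v ≠ x ∧ v ≠ y := by
  have h1 : v ∈ p.tail := List.mem_of_mem_dropLast hv
  have h2 : v ∈ p.dropLast := by
    rw [internalVerts, Set.mem_ofPred_eq, ← List.tail_dropLast] at hv
    exact List.mem_of_mem_tail hv
  refine ⟨List.mem_of_mem_tail h1, ?_, ?_⟩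
  · rintro rfl
    have hn := h.nodup
    rw [← List.cons_head?_tail h.head_eq] at hn
    exact (List.nodup_cons.1 hn).1 h1
  · rintro rfl
    have hn := h.nodup
    rw [← List.dropLast_append_getLast? v h.last_eq] at hn
    exact (List.nodup_append'.1 hn).2.2 h2 (by simp)

/-! ### Subdivisions -/

theorem not_unbalancedColorable_of_lt {N : ℕ}
    (hN : (N : ℕ∞) < D.unbalancedDichromaticNumber Z₁ Z₂) :
    ¬ D.UnbalancedColorable Z₁ Z₂ Set.univ N := by
  rintro ⟨c, hc, hcyc⟩
  have hle : D.unbalancedDichromaticNumber Z₁ Z₂ ≤ (Setoid.ker c).classes.encard := by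
    refine sInf_le ⟨_, Setoid.isPartition_classes (Setoid.ker c), ?_, rfl⟩
    rintro _ ⟨v, rfl⟩ ⟨l, hl, hu⟩
    obtain ⟨x, hx, y, hy, hne⟩ := hcyc l (hl.induced_of_mem fun _ _ => Set.mem_univ _) hu
    exact hne ((hl.verts_mem x hx).trans (hl.verts_mem y hy).symm)
  refine hN.not_ge (hle.trans ?_)
  have hsub : (Setoid.ker c).classes ⊆ (fun i => c ⁻¹' {i}) '' (Finset.range N : Set ℕ) := by
    rintro _ ⟨v, rfl⟩
    exact ⟨c v, by simpa using hc v (Set.mem_univ v), rfl⟩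
  calc _ ≤ _ := Set.encard_le_encard hsub
    _ ≤ _ := Set.encard_image_le _ _
    _ = N := by rw [Set.encard_coe_eq_coe_finsetCard, Finset.card_range]

theorem exists_injective_of_not_unbalancedColorable {W : Type*} [Finite W] [Finite V]
    (hD : D.Loopless) {X : Set V} (hX : ¬ D.UnbalancedColorable Z₁ Z₂ X (Nat.card W)) :
    ∃ branch : W → V, Function.Injective branch ∧ ∀ x, branch x ∈ X := by
  classical
  by_cases h : Nat.card W ≤ Nat.card X
  · have := Fintype.ofFinite W
    have := Fintype.ofFinite X
    simp only [Nat.card_eq_fintype_card] at h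
    obtain ⟨f⟩ := Function.Embedding.nonempty_of_card_le h
    exact ⟨fun x => f x, Subtype.val_injective.comp f.injective, fun x => (f x).2⟩
  · have e := Finite.equivFin X
    refine (hX (.of_injOn hD (fun v => if hv : v ∈ X then e ⟨v, hv⟩ else 0) ?_ ?_)).elim
    · intro v hv
      simp only [hv, dite_true]
      exact (e ⟨v, hv⟩).is_lt.trans (by omega)
    · intro v hv v' hv' hvv'
      simp only [hv, hv', dite_true] at hvv'
      exact congrArg Subtype.val (e.injective (Fin.ext hvv'))

universe u

/-- The new arc is routed with interior outside `J`, while the branch vertices and the paths for the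
other arcs are found inside `J`; disjointness is then automatic. -/
theorem exists_branching_paths {W : Type*} [Finite W] (F : Digraph W) (hF : F.Loopless)
    (a b r q : F.arcs → ℤ) (hq : ∀ e, 2 ≤ q e)
    (ha : ∀ e, Int.gcd (a e) (q e) = 1) (hb : ∀ e, Int.gcd (b e) (q e) = 1)
    (A : Finset F.arcs) :
    ∃ N : ℕ, ∀ (V : Type u) [Finite V] (D : Digraph V), D.Loopless →
      ∀ (Z₁ Z₂ : Set (V × V)) (X : Set V), ¬ D.UnbalancedColorable Z₁ Z₂ X N →
      ∃ (branch : W → V) (path : F.arcs → List V),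
        Function.Injective branch ∧ (∀ x, branch x ∈ X) ∧
        (∀ e ∈ A, IsRelPath D.Adj (branch e.1.1) (branch e.1.2) (path e) ∧
          (∀ v ∈ path e, v ∈ X) ∧ Disjoint (internalVerts (path e)) (Set.range branch) ∧
          a e * ((pathArcs (path e) ∩ Z₁).ncard : ℤ) +
            b e * ((pathArcs (path e) ∩ Z₂).ncard : ℤ) ≡ r e [ZMOD q e]) ∧
        ∀ e ∈ A, ∀ f ∈ A, e ≠ f → Disjoint (internalVerts (path e)) (internalVerts (path f)) := by
  classical
  induction A using Finset.induction_on with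
  | empty =>
    refine ⟨Nat.card W, fun V _ D hD Z₁ Z₂ X hX => ?_⟩
    obtain ⟨branch, h1, h2⟩ := exists_injective_of_not_unbalancedColorable (W := W) hD hX
    -- Arcs outside `A` carry the junk path `[]`.
    exact ⟨branch, fun _ => [], h1, h2, by simp, by simp⟩
  | insert e A heA ih =>
    obtain ⟨N, hN⟩ := ih
    obtain ⟨n, hn⟩ := Int.eq_ofNat_of_zero_le (show 0 ≤ q e by have := hq e; omega)
    have : NeZero n := ⟨by have := hq e; omega⟩
    have hunit : ∀ c : ℤ, Int.gcd c (q e) = 1 → IsUnit (c : ZMod n) := by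
      intro c hc
      rw [ZMod.coe_int_isUnit_iff_isCoprime]
      exact (Int.isCoprime_iff_gcd_eq_one.2 (hn ▸ hc)).symm
    refine ⟨4 * (4 * (blockBound (Nat.card (ZMod n)) (Nat.card (ZMod n)) + 1 + N)),
      fun V _ D hD Z₁ Z₂ X hX => ?_⟩
    obtain ⟨J, hJX, hJ, hlink⟩ := exists_linking_all_weights
      (w := arcWeight Z₁ Z₂ (a e : ZMod n) (b e)) hD
      (fun H hH u v => arcWeight_mem_iff (hunit _ (ha e)) (hunit _ (hb e)) hH u v) hX
    obtain ⟨branch, path, hinj, hbr, hpath, hdisj⟩ := hN V D hD Z₁ Z₂ J hJ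
    have hne : branch e.1.1 ≠ branch e.1.2 := fun h => hF e.1.1 (by
      have : F.Adj e.1.1 e.1.2 := e.2
      rwa [← hinj h] at this)
    obtain ⟨p, hp, hpX, hpw⟩ := hlink _ (hbr e.1.1) _ (hbr e.1.2) hne (r e)
    have hpJ : ∀ v ∈ internalVerts p, v ∉ J := by
      intro v hv
      obtain ⟨h1, h2, h3⟩ := hp.ne_of_mem_internalVerts hv
      rcases hpX v h1 with h | h | h
      exacts [h.2, (h2 h).elim, (h3 h).elim]
    have hpath' : ∀ f ∈ A, Function.update path e p f = path f := fun f hf =>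
      Function.update_of_ne (by rintro rfl; exact heA hf) _ _
    have hdp : ∀ f ∈ A, Disjoint (internalVerts p) (internalVerts (path f)) := by
      intro f hf
      rw [Set.disjoint_left]
      intro v hv hv'
      obtain ⟨h1, h2, -⟩ := hpath f hf
      exact hpJ v hv (h2 v (h1.ne_of_mem_internalVerts hv').1)
    refine ⟨branch, Function.update path e p, hinj, fun x => hJX (hbr x), ?_, ?_⟩
    · intro f hf
      rcases Finset.mem_insert.1 hf with rfl | hf
      · rw [Function.update_self]
        refine ⟨hp, ?_, ?_, ?_⟩
        · intro v hv
          rcases hpX v hv with h | rfl | rfl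
          exacts [h.1, hJX (hbr _), hJX (hbr _)]
        · rw [Set.disjoint_left]
          rintro v hv ⟨x, rfl⟩
          exact hpJ _ hv (hbr x)
        · rw [pathWeight_arcWeight _ _ hp.nodup] at hpw
          rw [hn, ← ZMod.intCast_eq_intCast_iff]
          push_cast
          exact hpw
      · rw [hpath' f hf]
        obtain ⟨h1, h2, h3, h4⟩ := hpath f hf
        exact ⟨h1, fun v hv => hJX (h2 v hv), h3, h4⟩
    · intro f hf g hg hfg
      rcases Finset.mem_insert.1 hf with rfl | hfA <;> rcases Finset.mem_insert.1 hg with rfl | hgA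
      · exact (hfg rfl).elim
      · rw [hpath' g hgA, Function.update_self]
        exact hdp g hgA
      · rw [hpath' f hfA, Function.update_self]
        exact (hdp f hfA).symm
      · rw [hpath' f hfA, hpath' g hgA]
        exact hdisj f hfA g hgA hfg

end Digraph

theorem theorem1p2 {W : Type*} [Finite W] (F : Digraph W) (hF : F.Loopless)
    (a b r q : F.arcs → ℤ) (hq : ∀ e, 2 ≤ q e)
    (ha : ∀ e, Int.gcd (a e) (q e) = 1) (hb : ∀ e, Int.gcd (b e) (q e) = 1) :
    ∃ N : ℕ, ∀ (V : Type*) [Finite V] (D : Digraph V), D.Loopless →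
      ∀ Z₁ Z₂ : Set (V × V), Z₁ ⊆ D.arcs → Z₂ ⊆ D.arcs →
      (N : ℕ∞) ≤ D.unbalancedDichromaticNumber Z₁ Z₂ →
      ∃ (H : D.Subdigraph) (branch : W → V) (path : F.arcs → List V),
        H.IsSubdivision F branch path ∧
        ∀ e : F.arcs,
          a e * ((Digraph.pathArcs (path e) ∩ Z₁).ncard : ℤ) +
            b e * ((Digraph.pathArcs (path e) ∩ Z₂).ncard : ℤ) ≡ r e [ZMOD q e] := by
  have := Fintype.ofFinite F.arcs
  obtain ⟨N, hN⟩ := Digraph.exists_branching_paths F hF a b r q hq ha hb Finset.univ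
  -- An `N`-colouring only yields at most `N` parts, so excluding it needs a number strictly above
  -- `N`.
  refine ⟨N + 1, fun V _ D hD Z₁ Z₂ _ _ hμ => ?_⟩
  obtain ⟨branch, path, hinj, -, hpath, hdisj⟩ := hN V D hD Z₁ Z₂ Set.univ
    (Digraph.not_unbalancedColorable_of_lt (lt_of_lt_of_le (by exact_mod_cast N.lt_succ_self) hμ))
  let H : D.Subdigraph :=
    { verts := Set.range branch ∪ ⋃ e : F.arcs, {x | x ∈ path e}
      arcs := ⋃ e : F.arcs, Digraph.pathArcs (path e)
      arcs_subset := Set.iUnion_subset fun e =>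
        Digraph.pathArcs_subset_of_isChain (hpath e (Finset.mem_univ e)).1.chain
      fst_mem := fun x hx => by
        obtain ⟨e, he⟩ := Set.mem_iUnion.1 hx
        exact .inr (Set.mem_iUnion.2 ⟨e, (Digraph.mem_of_mem_pathArcs he).1⟩)
      snd_mem := fun x hx => by
        obtain ⟨e, he⟩ := Set.mem_iUnion.1 hx
        exact .inr (Set.mem_iUnion.2 ⟨e, (Digraph.mem_of_mem_pathArcs he).2⟩) }
  refine ⟨H, branch, path, ⟨hinj, fun e => ?_, fun e => (hpath e (Finset.mem_univ e)).2.2.1,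
    fun e f => hdisj e (Finset.mem_univ e) f (Finset.mem_univ f), rfl, rfl⟩,
    fun e => (hpath e (Finset.mem_univ e)).2.2.2⟩
  have h := (hpath e (Finset.mem_univ e)).1
  exact ⟨h.nodup, h.head_eq, h.last_eq, fun x hx => .inr (Set.mem_iUnion.2 ⟨e, hx⟩),
    Set.subset_iUnion (fun e => Digraph.pathArcs (path e)) e⟩
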